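/- Let $n\ge 0$ and let $V$ be a Euclidean space of dimension $4n+4$, with unit sphere $S(V)$. Let $\mathcal F$ be a closed singular Riemannian foliation on $S(V)$: a partition of $S(V)$ into connected, injectively immersed smooth submanifolds (the leaves), each of which is a closed subset, such that every vector tangent to a leaf is the value of a smooth vector field on $S(V)$ that is everywhere tangent to the leaves, and every geodesic of $S(V)$ that is orthogonal to the leaf through its starting point is orthogonal to every leaf it meets. Let $K$ be a (Hausdorff, second countable) Lie group with Lie algebra $\mathfrak k$, and let $\rho\colon K\to SO(V)$ be an effective (that is, injective) smooth representation such that $\rho(K)$ is the maximal connected subgroup of $SO(V)$ that leaves each leaf of $\mathcal F$ invariant. Let $\rho_*\colon\mathfrak k\to\mathfrak{so}(V)$ be the differential of $\rho$ at the identity. Let $\mathfrak q$ be a quaternionic structure on $V$: a 3-dimensional subspace of $\mathfrak{so}(V)$ containing elements $J_1,J_2,J_3$ with $J_i^2=-\mathrm{Id}$ and $J_iJ_{i+1}=J_{i+2}$ for $i=1,2,3$ (indices modulo $3$). Let $Q$ be the connected Lie subgroup of $SO(V)$ with Lie algebra $\mathfrak q$. One says that $\mathfrak q$ preserves $\mathcal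 F$ if for every $p\in S(V)$ the orbit $Q\cdot p$ is contained in the leaf of $\mathcal F$ through $p$. Then the following are equivalent: (a) $\mathfrak q$ preserves $\mathcal F$; (b) there is a subgroup $S$ of $K$ such that $\rho(S)=Q$; (c) there is a Lie subalgebra $\mathfrak s$ of $\mathfrak k$ such that $\rho_*(\mathfrak s)=\mathfrak q$. Moreover, every subgroup $S$ as in (b) is isomorphic, as a topological group (and hence as a Lie group), to $SU_2$, and every subalgebra $\mathfrak s$ as in (c) is isomorphic, as a real Lie algebra, to $\mathfrak{su}_2$. -/

import Mathlib

open scoped Manifold ContDiff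

attribute [local instance 100] LieRing.ofAssociativeRing

noncomputable section

/-! ### Immersed submanifolds and singular Riemannian foliations of the unit sphere -/

/-- A connected, injectively immersed smooth submanifold (without boundary) of the vector space `V`:
a connected Hausdorff second countable smooth manifold `Carrier` of dimension `dim`, together with
an injective smooth immersion `emb` of it into `V`. -/
structure ImmersedSubmanifold (V : Type*) [NormedAddCommGroup V] [NormedSpace ℝ V] where
  dim : ℕ
  Carrier : Type
  [topology : TopologicalSpace Carrier]
  [charts : ChartedSpace (EuclideanSpace ℝ (Fin dim)) Carrier]
  [smooth : IsManifold (𝓡 dim) ∞ Carrier]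
  [hausdorff : T2Space Carrier]
  [secondCountable : SecondCountableTopology Carrier]
  [connected : ConnectedSpace Carrier]
  emb : Carrier → V
  contMDiff_emb : ContMDiff (𝓡 dim) 𝓘(ℝ, V) ∞ emb
  injective_emb : Function.Injective emb
  injective_mfderiv_emb : ∀ x : Carrier,
    Function.Injective (mfderiv (𝓡 dim) 𝓘(ℝ, V) emb x : TangentSpace (𝓡 dim) x → V)

attribute [instance] ImmersedSubmanifold.topology ImmersedSubmanifold.charts
  ImmersedSubmanifold.smooth ImmersedSubmanifold.hausdorff ImmersedSubmanifold.secondCountable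
  ImmersedSubmanifold.connected

namespace ImmersedSubmanifold

variable {V : Type*} [NormedAddCommGroup V] [NormedSpace ℝ V]

/-- The underlying subset of `V`. -/
def points (L : ImmersedSubmanifold V) : Set V := Set.range L.emb

/-- The tangent space of the submanifold at the point `L.emb x`, as a linear subspace of `V`. -/
def tangent (L : ImmersedSubmanifold V) (x : L.Carrier) : Submodule ℝ V :=
  LinearMap.range
    (mfderiv (𝓡 L.dim) 𝓘(ℝ, V) L.emb x : TangentSpace (𝓡 L.dim) x →L[ℝ] V).toLinearMap

end ImmersedSubmanifold

/-- A singular Riemannian foliation on the unit sphere `S(V)` of a Euclidean space `V`: a partition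
of `S(V)` into connected injectively immersed submanifolds (the leaves) such that
* every vector tangent to a leaf is the value of a smooth vector field which is everywhere tangent
  to the leaves (vector fields on `S(V)` are given as restrictions of smooth maps `V → V`);
* every geodesic of `S(V)`, i.e. great circle, which is orthogonal to the leaf through its starting
  point is orthogonal to every leaf it meets. -/
structure SphereFoliation (V : Type*) [NormedAddCommGroup V] [InnerProductSpace ℝ V] where
  Index : Type
  leaf : Index → ImmersedSubmanifold V
  leaf_subset : ∀ i, (leaf i).points ⊆ Metric.sphere (0 : V) 1
  existsUnique_leaf : ∀ p ∈ Metric.sphere (0 : V) 1, ∃! i, p ∈ (leaf i).points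
  exists_vectorField : ∀ (i : Index) (x : (leaf i).Carrier), ∀ v ∈ (leaf i).tangent x,
    ∃ X : V → V, ContDiff ℝ ∞ X ∧
      (∀ (j : Index) (y : (leaf j).Carrier), X ((leaf j).emb y) ∈ (leaf j).tangent y) ∧
      X ((leaf i).emb x) = v
  transnormal : ∀ (i : Index) (x : (leaf i).Carrier) (v : V),
    ‖v‖ = 1 → inner ℝ ((leaf i).emb x) v = 0 → v ∈ ((leaf i).tangent x)ᗮ →
    ∀ (t : ℝ) (j : Index) (y : (leaf j).Carrier),
      (leaf j).emb y = Real.cos t • (leaf i).emb x + Real.sin t • v →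
      -Real.sin t • (leaf i).emb x + Real.cos t • v ∈ ((leaf j).tangent y)ᗮ

/-- A closed foliation: all leaves are closed. -/
def SphereFoliation.IsClosedFoliation {V : Type*} [NormedAddCommGroup V] [InnerProductSpace ℝ V]
    (F : SphereFoliation V) : Prop :=
  ∀ i, IsClosed (F.leaf i).points

section Orthogonal

variable (V : Type*) [NormedAddCommGroup V] [InnerProductSpace ℝ V] [CompleteSpace V]

/-- The special orthogonal group `SO(V)`, with the topology induced from `V →L[ℝ] V`. -/
def SO : Subgroup (unitary (V →L[ℝ] V)) where
  carrier := {g | (g : V →L[ℝ] V).det = 1}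
  one_mem' := by
    change LinearMap.det ((1 : V →L[ℝ] V) : V →ₗ[ℝ] V) = 1
    exact LinearMap.det_id
  mul_mem' := by
    intro a b ha hb
    have h : LinearMap.det (((a : V →L[ℝ] V) : V →ₗ[ℝ] V) * ((b : V →L[ℝ] V) : V →ₗ[ℝ] V)) = 1 := by
      rw [map_mul]
      change (a : V →L[ℝ] V).det * (b : V →L[ℝ] V).det = 1
      rw [ha, hb, one_mul]
    exact h
  inv_mem' := by
    intro a ha
    have h : LinearMap.det (((a⁻¹ : unitary (V →L[ℝ] V)) : V →L[ℝ] V) : V →ₗ[ℝ] V) *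
        LinearMap.det ((a : V →L[ℝ] V) : V →ₗ[ℝ] V) = 1 := by
      rw [← map_mul]
      have h2 : ((((a⁻¹ : unitary (V →L[ℝ] V)) : V →L[ℝ] V) : V →ₗ[ℝ] V) *
          ((a : V →L[ℝ] V) : V →ₗ[ℝ] V)) = LinearMap.id := by
        have h3 : ((a⁻¹ : unitary (V →L[ℝ] V)) : V →L[ℝ] V) * (a : V →L[ℝ] V) = 1 := by
          rw [← Submonoid.coe_mul, inv_mul_cancel, Submonoid.coe_one]
        ext v
        exact congrArg (fun f : V →L[ℝ] V => f v) h3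
      rw [h2]
      exact LinearMap.det_id
    have ha' : LinearMap.det ((a : V →L[ℝ] V) : V →ₗ[ℝ] V) = 1 := ha
    rw [ha', mul_one] at h
    exact h

variable {V}

/-- An element of `SO(V)` viewed as a continuous linear endomorphism of `V`. -/
def SO.toEnd (g : SO V) : V →L[ℝ] V := ((g : unitary (V →L[ℝ] V)) : V →L[ℝ] V)

/-- A linear quaternionic structure on `V`: a 3-dimensional subspace `q` of `𝔰𝔬(V)` (the
skew-adjoint endomorphisms of `V`) containing elements `J₁, J₂, J₃` with `Jᵢ² = -Id` and
`Jᵢ Jᵢ₊₁ = Jᵢ₊₂`, the indices being taken modulo 3. -/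
def IsQuaternionicStructure (q : Submodule ℝ (V →L[ℝ] V)) : Prop :=
  q ≤ skewAdjoint.submodule ℝ (V →L[ℝ] V) ∧ Module.finrank ℝ q = 3 ∧
    ∃ J : Fin 3 → (V →L[ℝ] V), (∀ i, J i ∈ q) ∧ (∀ i, J i * J i = -1) ∧
      ∀ i, J i * J (i + 1) = J (i + 2)

/-- The connected Lie subgroup of `SO(V)` with Lie algebra `q ⊆ 𝔰𝔬(V)`, i.e. the subgroup generated
by the exponentials of the elements of `q`. -/
def connectedSubgroup (q : Submodule ℝ (V →L[ℝ] V)) : Subgroup (SO V) :=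
  Subgroup.closure {g | ∃ X ∈ q, SO.toEnd g = NormedSpace.exp X}

/-- The subgroup `H` of `SO(V)` leaves each leaf of the foliation `F` invariant. -/
def LeavesInvariant (F : SphereFoliation V) (H : Subgroup (SO V)) : Prop :=
  ∀ g ∈ H, ∀ i, SO.toEnd g '' (F.leaf i).points = (F.leaf i).points

/-- `K₀` is the maximal connected subgroup of `SO(V)` leaving each leaf of `F` invariant. -/
def IsMaximalConnectedInvariant (F : SphereFoliation V) (K₀ : Subgroup (SO V)) : Prop :=
  IsGreatest {H : Subgroup (SO V) | IsConnected (H : Set (SO V)) ∧ LeavesInvariant F H} K₀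

/-- `q` preserves the foliation `F`: for each `p ∈ S(V)`, the orbit of `p` under the connected
subgroup with Lie algebra `q` is contained in the leaf through `p`. -/
def PreservesFoliation (F : SphereFoliation V) (q : Submodule ℝ (V →L[ℝ] V)) : Prop :=
  ∀ p ∈ Metric.sphere (0 : V) 1, ∀ i, p ∈ (F.leaf i).points →
    ∀ g ∈ connectedSubgroup q, SO.toEnd g p ∈ (F.leaf i).points

end Orthogonal

/-! ### Lie groups and their representations -/

/-- A real smooth Lie group has the smoothness needed for Mathlib's bracket on its tangent space
at the identity. -/
instance LieGroup.minSmoothnessThree {k : ℕ} {K : Type*} [TopologicalSpace K]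
    [ChartedSpace (EuclideanSpace ℝ (Fin k)) K] [Group K] [LieGroup (𝓡 k) ∞ K] :
    LieGroup (𝓡 k) (minSmoothness ℝ 3) K := by
  rw [minSmoothness_of_isRCLikeNormedField]
  infer_instance

section Representation

variable (k : ℕ) {K : Type*} [TopologicalSpace K]
  [ChartedSpace (EuclideanSpace ℝ (Fin k)) K] [Group K]
  {V : Type*} [NormedAddCommGroup V] [InnerProductSpace ℝ V] [CompleteSpace V]

/-- Smoothness of a homomorphism `K → SO(V)`, where `SO(V)` is viewed as an embedded submanifold of
the vector space `V →L[ℝ] V`. -/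
def IsSmoothRep (ρ : K →* SO V) : Prop :=
  ContMDiff (𝓡 k) 𝓘(ℝ, V →L[ℝ] V) ∞ (fun g : K => SO.toEnd (ρ g))

/-- The differential at the identity `ρ_* : 𝔨 → 𝔰𝔬(V) ⊆ End V` of a homomorphism `ρ : K → SO(V)`. -/
def repDeriv (ρ : K →* SO V) : GroupLieAlgebra (𝓡 k) K →ₗ[ℝ] (V →L[ℝ] V) :=
  (mfderiv (𝓡 k) 𝓘(ℝ, V →L[ℝ] V) (fun g : K => SO.toEnd (ρ g)) 1 :
    GroupLieAlgebra (𝓡 k) K →L[ℝ] (V →L[ℝ] V)).toLinearMap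

end Representation

/-- The real Lie algebra `𝔰𝔲₂` of traceless skew-Hermitian complex `2 × 2` matrices. -/
def su2 : LieSubalgebra ℝ (Matrix (Fin 2) (Fin 2) ℂ) where
  carrier := {A | A.conjTranspose = -A ∧ A.trace = 0}
  zero_mem' := by simp
  add_mem' := by
    rintro A B ⟨hA, hA'⟩ ⟨hB, hB'⟩
    refine ⟨?_, ?_⟩
    · rw [Matrix.conjTranspose_add, hA, hB, neg_add]
    · rw [Matrix.trace_add, hA', hB', add_zero]
  smul_mem' := by
    rintro c A ⟨hA, hA'⟩
    refine ⟨?_, ?_⟩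
    · rw [Matrix.conjTranspose_smul, hA, star_trivial, smul_neg]
    · rw [Matrix.trace_smul, hA', smul_zero]
  lie_mem' := by
    rintro A B ⟨hA, -⟩ ⟨hB, -⟩
    refine ⟨?_, ?_⟩
    · rw [Ring.lie_def, Matrix.conjTranspose_sub, Matrix.conjTranspose_mul,
        Matrix.conjTranspose_mul, hA, hB]
      noncomm_ring
    · rw [Ring.lie_def, Matrix.trace_sub, Matrix.trace_mul_comm, sub_self]

end

/-!
The three conditions are compared through the group `ρ(K)`. Since the leaves are closed, the closure
of `ρ(K)` is again connected and leaves every leaf invariant, so `ρ(K)` is closed by maximality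
(`IsMaximalConnectedInvariant.isClosed`). By the open mapping theorem for `σ`-compact groups, `ρ` is
then a topological embedding (`IsSmoothRep.isInducing`).

If `q` preserves the foliation, then the connected group `Q` leaves the leaves invariant, so
`Q ⊆ ρ(K)` by maximality, and `S = ρ⁻¹(Q)` is as wanted. If `Q = ρ(S)`, then each one-parameter
group `exp (tX)` with `X ∈ q` lifts to a continuous curve in `K`. As `ρ` is an immersion, this curve is
`O(t)` in a chart, and a limit of difference quotients shows that `X` lies in the image of `ρ_*`
(`exists_eq_of_hasDerivAt_comp`, `le_range_repDeriv`); so `q = ρ_*(ρ_*⁻¹(q))`. If `q = ρ_*(s)`, then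
`ρ` maps the integral curves of left invariant vector fields to one-parameter groups
(`exists_curve_hom_eq_exp`), so `Q` is contained in `ρ(K)`, which leaves the leaves invariant.

The same integral curves show that `ρ_*` is injective (`homDeriv_injective`). It respects brackets
because `ρ` relates left invariant vector fields on `K` to the fields `A ↦ A * X` on `End V`
(`mfderiv_mlieBracket_of_related`, `homDeriv_bracket`).

For the last two claims, `J₁, J₂, J₃` define an algebra homomorphism `Φ : ℍ → End V` with
`q = Φ(Im ℍ)`. Every unit quaternion is the exponential of an imaginary one, so `Q` is the image
under `Φ` of the group of unit quaternions. The matrix model `quaternionToMatrix` identifies `Im ℍ`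
with `𝔰𝔲₂` and the unit quaternions with `SU₂`.
-/

open scoped Quaternion
open VectorField Filter Topology

noncomputable section

/-! ### Quaternions -/

/-- The Lie algebra of imaginary quaternions. -/
def imQuaternion : LieSubalgebra ℝ ℍ[ℝ] where
  carrier := {x | x.re = 0}
  zero_mem' := by simp
  add_mem' := by
    intro x y hx hy
    simp_all
  smul_mem' := by
    intro c x hx
    simp_all
  lie_mem' := by
    intro x y hx hy
    simp only [Set.mem_ofPred_eq, Ring.lie_def] at *
    simp [hx, hy]
    ring

theorem mem_imQuaternion {x : ℍ[ℝ]} : x ∈ imQuaternion ↔ x.re = 0 := Iff.rfl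

theorem finrank_imQuaternion : Module.finrank ℝ imQuaternion.toSubmodule = 3 := by
  have h : imQuaternion.toSubmodule = LinearMap.ker (QuaternionAlgebra.reₗ (-1 : ℝ) 0 (-1)) := by
    ext x
    rfl
  have hs : Function.Surjective (QuaternionAlgebra.reₗ (-1 : ℝ) 0 (-1)) := fun r =>
    ⟨⟨r, 0, 0, 0⟩, rfl⟩
  have h1 := LinearMap.finrank_range_add_finrank_ker (QuaternionAlgebra.reₗ (-1 : ℝ) 0 (-1))
  rw [LinearMap.range_eq_top.2 hs, finrank_top, Module.finrank_self,
    QuaternionAlgebra.finrank_eq_four] at h1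
  rw [h]
  exact Nat.add_left_cancel h1

theorem Quaternion.norm_sq_eq (x : ℍ[ℝ]) :
    ‖x‖ ^ 2 = x.re ^ 2 + x.imI ^ 2 + x.imJ ^ 2 + x.imK ^ 2 := by
  rw [sq, ← Quaternion.normSq_eq_norm_mul_self, Quaternion.normSq_def']

/-- Every unit quaternion is the exponential of an imaginary quaternion. -/
theorem exists_imQuaternion_exp_eq {u : ℍ[ℝ]} (hu : ‖u‖ = 1) :
    ∃ x ∈ imQuaternion, NormedSpace.exp x = u := by
  -- polar form: `u = cos θ + (sin θ) v`, where `θ = arccos (re u)` and `v = im u / ‖im u‖`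
  have hsum : u.re ^ 2 + ‖u.im‖ ^ 2 = 1 := by
    have h := Quaternion.norm_sq_eq u
    have h' := Quaternion.norm_sq_eq u.im
    simp only [hu, Quaternion.re_im, Quaternion.imI_im, Quaternion.imJ_im,
      Quaternion.imK_im] at h h'
    linarith
  have hcos : Real.cos (Real.arccos u.re) = u.re :=
    Real.cos_arccos (by nlinarith [sq_nonneg ‖u.im‖]) (by nlinarith [sq_nonneg ‖u.im‖])
  have hsin : Real.sin (Real.arccos u.re) = ‖u.im‖ := by
    rw [Real.sin_arccos, sub_eq_of_eq_add' hsum.symm, Real.sqrt_sq (norm_nonneg _)]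
  by_cases h0 : u.im = 0
  · have hre : u.re ^ 2 = 1 := by simpa [h0] using hsum
    have hu' : (u.re : ℍ[ℝ]) = u := by
      conv_rhs => rw [← Quaternion.re_add_im u, h0, add_zero]
    rcases sq_eq_sq_iff_eq_or_eq_neg.1 (hre.trans (one_pow 2).symm) with h | h
    · exact ⟨0, imQuaternion.zero_mem, by rw [NormedSpace.exp_zero, ← hu', h]; rfl⟩
    -- `-1` is the exponential of `π i`
    · obtain ⟨w, hw, hwI, hwJ, hwK⟩ :
          ∃ w : ℍ[ℝ], w.re = 0 ∧ w.imI = Real.pi ∧ w.imJ = 0 ∧ w.imK = 0 :=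
        ⟨⟨0, Real.pi, 0, 0⟩, rfl, rfl, rfl, rfl⟩
      have hn : ‖w‖ = Real.pi := by
        rw [← sq_eq_sq₀ (norm_nonneg _) Real.pi_pos.le, Quaternion.norm_sq_eq, hw, hwI, hwJ, hwK]
        simp
      refine ⟨w, hw, ?_⟩
      rw [Quaternion.exp_of_re_eq_zero _ hw, hn, Real.cos_pi, Real.sin_pi, ← hu', h]
      simp
  · have hpos : 0 < ‖u.im‖ := norm_pos_iff.2 h0
    have hθ : 0 < Real.arccos u.re := by
      rcases (Real.arccos_nonneg u.re).lt_or_eq with h | h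
      · exact h
      · rw [← h, Real.sin_zero] at hsin
        exact absurd hsin hpos.ne
    have hn : ‖(Real.arccos u.re / ‖u.im‖) • u.im‖ = Real.arccos u.re := by
      rw [norm_smul, norm_div, norm_norm, Real.norm_of_nonneg hθ.le, div_mul_cancel₀ _ hpos.ne']
    refine ⟨(Real.arccos u.re / ‖u.im‖) • u.im, by simp [mem_imQuaternion], ?_⟩
    rw [Quaternion.exp_of_re_eq_zero _ (by simp), hn, hcos, hsin, smul_smul,
      div_mul_div_cancel₀ hθ.ne', div_self hpos.ne', one_smul, Quaternion.re_add_im]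

theorem norm_exp_imQuaternion {x : ℍ[ℝ]} (hx : x ∈ imQuaternion) : ‖NormedSpace.exp x‖ = 1 := by
  rw [Quaternion.norm_exp, mem_imQuaternion.1 hx, NormedSpace.exp_zero, norm_one]

/-- The quaternion basis given by `J₁`, `J₂`, `J₃` with `Jᵢ² = -1` and `Jᵢ Jᵢ₊₁ = Jᵢ₊₂`, stored as
`J 0`, `J 1`, `J 2`. The parameters `-1, 0, -1` are those of Hamilton's quaternions. -/
def quaternionBasisOfTriple {A : Type*} [Ring A] [Algebra ℝ A] (J : Fin 3 → A)
    (hsq : ∀ i, J i * J i = -1) (hmul : ∀ i, J i * J (i + 1) = J (i + 2)) :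
    QuaternionAlgebra.Basis A (-1 : ℝ) 0 (-1) where
  i := J 0
  j := J 1
  k := J 2
  i_mul_i := by simp [hsq]
  j_mul_j := by simp [hsq]
  i_mul_j := hmul 0
  j_mul_i := by
    have h1 : J 1 * J 2 = J 0 := hmul 1
    have h2 : J 1 * (J 1 * J 2) = J 1 * J 0 := by rw [h1]
    rw [← mul_assoc, hsq] at h2
    simpa using h2.symm

/-- The algebra homomorphism from the quaternions which sends `i`, `j`, `k` to `J₁`, `J₂`, `J₃`,
where `Jᵢ² = -1` and `Jᵢ Jᵢ₊₁ = Jᵢ₊₂`. -/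
def quaternionLift {A : Type*} [Ring A] [Algebra ℝ A] (J : Fin 3 → A)
    (hsq : ∀ i, J i * J i = -1) (hmul : ∀ i, J i * J (i + 1) = J (i + 2)) : ℍ[ℝ] →ₐ[ℝ] A :=
  (quaternionBasisOfTriple J hsq hmul).liftHom

theorem quaternionLift_apply {A : Type*} [Ring A] [Algebra ℝ A] (J : Fin 3 → A)
    (hsq : ∀ i, J i * J i = -1) (hmul : ∀ i, J i * J (i + 1) = J (i + 2)) (x : ℍ[ℝ]) :
    quaternionLift J hsq hmul x =
      algebraMap ℝ A x.re + x.imI • J 0 + x.imJ • J 1 + x.imK • J 2 :=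
  rfl

section AlgHom

variable {A : Type*} [NormedRing A] [NormedAlgebra ℝ A] (Φ : ℍ[ℝ] →ₐ[ℝ] A)

theorem Quaternion.algHom_injective [Nontrivial A] : Function.Injective Φ :=
  (Φ : ℍ[ℝ] →+* A).injective

theorem Quaternion.algHom_continuous : Continuous Φ :=
  LinearMap.continuous_of_finiteDimensional Φ.toLinearMap

theorem Quaternion.algHom_exp [CompleteSpace A] (x : ℍ[ℝ]) :
    Φ (NormedSpace.exp x) = NormedSpace.exp (Φ x) := by
  let _ : Algebra ℚ ℍ[ℝ] := inferInstance
  let _ : NormedAlgebra ℚ ℍ[ℝ] := NormedAlgebra.restrictScalars ℚ ℝ ℍ[ℝ]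
  let _ : NormedAlgebra ℚ A := NormedAlgebra.restrictScalars ℚ ℝ A
  exact NormedSpace.map_exp Φ (Quaternion.algHom_continuous Φ) x

end AlgHom

/-- A continuous bijective homomorphism from a compact group to a Hausdorff group is an isomorphism
of topological groups. -/
def ContinuousMulEquiv.ofContinuousBijective {G H : Type*} [Group G] [Group H]
    [TopologicalSpace G] [TopologicalSpace H] [CompactSpace G] [T2Space H] (f : G →* H)
    (hc : Continuous f) (hb : Function.Bijective f) : G ≃ₜ* H :=
  { MulEquiv.ofBijective f hb with
    continuous_toFun := hc
    continuous_invFun :=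
      (Continuous.homeoOfEquivCompactToT2 (f := Equiv.ofBijective f hb) hc).symm.continuous }

/-! ### `SU(2)` and `𝔰𝔲(2)` -/

open Complex in
/-- The representation of the quaternions by complex `2 × 2` matrices, normalized so that conjugation
of quaternions corresponds to the conjugate transpose. -/
def quaternionToMatrix : ℍ[ℝ] →ₐ[ℝ] Matrix (Fin 2) (Fin 2) ℂ :=
  quaternionLift (A := Matrix (Fin 2) (Fin 2) ℂ)
    ![!![I, 0; 0, -I], !![0, 1; -1, 0], !![0, I; I, 0]]
    (by
      intro i; fin_cases i <;> ext a b <;> fin_cases a <;> fin_cases b <;> simp)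
    (by
      intro i; fin_cases i <;> ext a b <;> fin_cases a <;> fin_cases b <;> simp [Fin.add_def])

theorem quaternionToMatrix_apply (x : ℍ[ℝ]) : quaternionToMatrix x =
    !![⟨x.re, x.imI⟩, ⟨x.imJ, x.imK⟩; ⟨-x.imJ, x.imK⟩, ⟨x.re, -x.imI⟩] := by
  rw [quaternionToMatrix, quaternionLift_apply]
  ext a b
  fin_cases a <;> fin_cases b <;> apply Complex.ext <;> simp [Matrix.algebraMap_matrix_apply]

theorem map_imQuaternion_toMatrix :
    imQuaternion.map (quaternionToMatrix : ℍ[ℝ] →ₗ⁅ℝ⁆ Matrix (Fin 2) (Fin 2) ℂ) = su2 := by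
  ext A
  rw [LieSubalgebra.mem_map]
  constructor
  · rintro ⟨x, hx, rfl⟩
    rw [mem_imQuaternion] at hx
    change (quaternionToMatrix x).conjTranspose = -quaternionToMatrix x ∧
      (quaternionToMatrix x).trace = 0
    rw [quaternionToMatrix_apply]
    constructor
    · ext a b
      fin_cases a <;> fin_cases b <;> apply Complex.ext <;> simp [hx]
    · apply Complex.ext <;> simp [hx, Matrix.trace]
  · rintro ⟨h1, h2⟩
    have e00 := congr_fun₂ h1 0 0
    have e01 := congr_fun₂ h1 1 0
    simp only [Matrix.conjTranspose_apply, Matrix.neg_apply, Complex.ext_iff, RCLike.star_def,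
      Complex.conj_re, Complex.conj_im, Complex.neg_re, Complex.neg_im, Matrix.trace,
      Fin.sum_univ_two, Matrix.diag_apply, Complex.add_re, Complex.add_im,
      Complex.zero_re, Complex.zero_im] at e00 e01 h2
    refine ⟨⟨0, (A 0 0).im, (A 0 1).re, (A 0 1).im⟩, rfl, ?_⟩
    refine (quaternionToMatrix_apply _).trans ?_
    ext a b
    fin_cases a <;> fin_cases b <;> apply Complex.ext <;> simp <;> linarith

theorem quaternionToMatrix_star (x : ℍ[ℝ]) :
    quaternionToMatrix (star x) = (quaternionToMatrix x).conjTranspose := by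
  rw [quaternionToMatrix_apply, quaternionToMatrix_apply]
  ext a b
  fin_cases a <;> fin_cases b <;> apply Complex.ext <;> simp

theorem det_quaternionToMatrix (x : ℍ[ℝ]) :
    (quaternionToMatrix x).det = ((‖x‖ ^ 2 : ℝ) : ℂ) := by
  rw [quaternionToMatrix_apply, Matrix.det_fin_two_of, Quaternion.norm_sq_eq]
  apply Complex.ext
  · simp only [Complex.sub_re, Complex.mul_re, Complex.ofReal_re]
    ring
  · simp only [Complex.sub_im, Complex.mul_im, Complex.ofReal_im]
    ring

theorem quaternionToMatrix_mem {x : ℍ[ℝ]} (hx : ‖x‖ = 1) :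
    quaternionToMatrix x ∈ Matrix.specialUnitaryGroup (Fin 2) ℂ := by
  rw [Matrix.mem_specialUnitaryGroup_iff, Matrix.mem_unitaryGroup_iff, Matrix.star_eq_conjTranspose,
    ← quaternionToMatrix_star, ← map_mul, Quaternion.self_mul_star, det_quaternionToMatrix,
    Quaternion.normSq_eq_norm_mul_self, hx]
  simp

theorem exists_quaternionToMatrix_eq {A : Matrix (Fin 2) (Fin 2) ℂ}
    (hA : A ∈ Matrix.specialUnitaryGroup (Fin 2) ℂ) : ∃ x, ‖x‖ = 1 ∧ quaternionToMatrix x = A := by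
  rw [Matrix.mem_specialUnitaryGroup_iff, Matrix.mem_unitaryGroup_iff',
    Matrix.star_eq_conjTranspose] at hA
  obtain ⟨h1, h2⟩ := hA
  -- both are the inverse of `A`; comparing entries shows that `A` has the form of a quaternion
  have h3 : A.conjTranspose = A.adjugate := by
    have h : A.conjTranspose * (A * A.adjugate) = A.adjugate := by
      rw [← mul_assoc, h1, one_mul]
    rwa [Matrix.mul_adjugate, h2, one_smul, mul_one] at h
  rw [Matrix.adjugate_fin_two] at h3
  have e00 := congr_fun₂ h3 0 0
  have e01 := congr_fun₂ h3 0 1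
  simp only [Matrix.conjTranspose_apply, Complex.ext_iff, RCLike.star_def,
    Complex.conj_re, Complex.conj_im, Matrix.of_apply, Matrix.cons_val', Matrix.cons_val_zero,
    Matrix.cons_val_one, Complex.neg_re, Complex.neg_im, Matrix.cons_val_fin_one] at e00 e01
  have hx : quaternionToMatrix ⟨(A 0 0).re, (A 0 0).im, (A 0 1).re, (A 0 1).im⟩ = A := by
    refine (quaternionToMatrix_apply _).trans ?_
    ext a b
    fin_cases a <;> fin_cases b <;> apply Complex.ext <;> simp <;> linarith
  refine ⟨_, ?_, hx⟩
  have h4 := det_quaternionToMatrix ⟨(A 0 0).re, (A 0 0).im, (A 0 1).re, (A 0 1).im⟩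
  rw [hx, h2] at h4
  have h5 := Complex.ofReal_injective (Complex.ofReal_one.trans h4)
  exact (pow_eq_one_iff_of_nonneg (norm_nonneg _) two_ne_zero).1 h5.symm

/-- The group of unit quaternions is isomorphic to `SU(2)`. -/
theorem nonempty_unitQuaternion_equiv_specialUnitaryGroup :
    Nonempty (Metric.sphere (0 : ℍ[ℝ]) 1 ≃ₜ* Matrix.specialUnitaryGroup (Fin 2) ℂ) := by
  let f : Metric.sphere (0 : ℍ[ℝ]) 1 →* Matrix.specialUnitaryGroup (Fin 2) ℂ :=
    { toFun := fun x =>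
        ⟨quaternionToMatrix x, quaternionToMatrix_mem (mem_sphere_zero_iff_norm.1 x.2)⟩
      map_one' := Subtype.ext (map_one quaternionToMatrix)
      map_mul' := fun x y => Subtype.ext (map_mul quaternionToMatrix _ _) }
  have hc : Continuous f := by
    refine Continuous.subtype_mk ?_ _
    exact (LinearMap.continuous_of_finiteDimensional quaternionToMatrix.toLinearMap).comp
      continuous_subtype_val
  have hb : Function.Bijective f := by
    constructor
    · intro x y h
      exact Subtype.ext ((quaternionToMatrix : ℍ[ℝ] →+* Matrix (Fin 2) (Fin 2) ℂ).injective
        (congrArg Subtype.val h))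
    · rintro ⟨A, hA⟩
      obtain ⟨x, hx, hxA⟩ := exists_quaternionToMatrix_eq hA
      exact ⟨⟨x, by simpa using hx⟩, Subtype.ext hxA⟩
  exact ⟨ContinuousMulEquiv.ofContinuousBijective f hc hb⟩

/-! ### Related vector fields -/

/-- Brackets of related vector fields are related, because the second derivative is symmetric. -/
theorem fderiv_lieBracket_of_related {E F : Type*} [NormedAddCommGroup E] [NormedSpace ℝ E]
    [NormedAddCommGroup F] [NormedSpace ℝ F] {f : E → F} {x : E} (hf : ContDiffAt ℝ 2 f x)
    {V W : E → E} {V' W' : F → F} (hV : DifferentiableAt ℝ V x) (hW : DifferentiableAt ℝ W x)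
    (hV' : DifferentiableAt ℝ V' (f x)) (hW' : DifferentiableAt ℝ W' (f x))
    (hVV' : ∀ᶠ y in 𝓝 x, fderiv ℝ f y (V y) = V' (f y))
    (hWW' : ∀ᶠ y in 𝓝 x, fderiv ℝ f y (W y) = W' (f y)) :
    fderiv ℝ f x (lieBracket ℝ V W x) = lieBracket ℝ V' W' (f x) := by
  have hfd : DifferentiableAt ℝ f x := hf.differentiableAt (by norm_num)
  have hdf : DifferentiableAt ℝ (fderiv ℝ f) x :=
    (hf.fderiv_right (m := 1) (by norm_num)).differentiableAt (by norm_num)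
  have hsymm : IsSymmSndFDerivAt ℝ f x := hf.isSymmSndFDerivAt (by simp)
  -- differentiate the relation `df (U) = U' ∘ f` in the direction `z`
  have key : ∀ {U : E → E} {U' : F → F}, DifferentiableAt ℝ U x → DifferentiableAt ℝ U' (f x) →
      (∀ᶠ y in 𝓝 x, fderiv ℝ f y (U y) = U' (f y)) → ∀ z,
      fderiv ℝ f x (fderiv ℝ U x z) =
        fderiv ℝ U' (f x) (fderiv ℝ f x z) - fderiv ℝ (fderiv ℝ f) x z (U x) := by
    intro U U' hU hU' hUU' z
    have h1 := (hdf.hasFDerivAt.clm_apply hU.hasFDerivAt).congr_of_eventuallyEq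
      (EventuallyEq.symm hUU')
    have h2 : HasFDerivAt (fun y => U' (f y)) _ x := hU'.hasFDerivAt.comp x hfd.hasFDerivAt
    have h3 := congrArg (fun L : E →L[ℝ] F => L z) (h1.unique h2)
    simp only [_root_.add_apply, ContinuousLinearMap.comp_apply,
      ContinuousLinearMap.flip_apply] at h3
    exact eq_sub_of_add_eq h3
  rw [lieBracket_eq, lieBracket_eq, map_sub, key hW hW' hWW', key hV hV' hVV', hVV'.self_of_nhds,
    hWW'.self_of_nhds, hsymm.eq (V x) (W x)]
  exact sub_sub_sub_cancel_right _ _ _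

section Manifold

variable {E : Type*} [NormedAddCommGroup E] [NormedSpace ℝ E] [CompleteSpace E]
  {F : Type*} [NormedAddCommGroup F] [NormedSpace ℝ F]
  {M : Type*} [TopologicalSpace M] [ChartedSpace E M] [IsManifold 𝓘(ℝ, E) ∞ M]

/-- Brackets of related vector fields are related, for a map from a manifold to a normed space; the
derivative of the map need not be invertible, unlike for pullbacks of vector fields. -/
theorem mfderiv_mlieBracket_of_related {f : M → F} (hf : ContMDiff 𝓘(ℝ, E) 𝓘(ℝ, F) ∞ f) {x : M}
    {V W : Π y : M, TangentSpace 𝓘(ℝ, E) y} {V' W' : F → F}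
    (hV : ContMDiffAt 𝓘(ℝ, E) 𝓘(ℝ, E).tangent 1 (fun y => (V y : TangentBundle 𝓘(ℝ, E) M)) x)
    (hW : ContMDiffAt 𝓘(ℝ, E) 𝓘(ℝ, E).tangent 1 (fun y => (W y : TangentBundle 𝓘(ℝ, E) M)) x)
    (hV' : DifferentiableAt ℝ V' (f x)) (hW' : DifferentiableAt ℝ W' (f x))
    (hVV' : ∀ y, mfderiv 𝓘(ℝ, E) 𝓘(ℝ, F) f y (V y) = V' (f y))
    (hWW' : ∀ y, mfderiv 𝓘(ℝ, E) 𝓘(ℝ, F) f y (W y) = W' (f y)) :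
    mfderiv 𝓘(ℝ, E) 𝓘(ℝ, F) f x (mlieBracket 𝓘(ℝ, E) V W x) = lieBracket ℝ V' W' (f x) := by
  have hsrc : x ∈ (extChartAt 𝓘(ℝ, E) x).source := mem_extChartAt_source x
  have hfx : f ((extChartAt 𝓘(ℝ, E) x).symm (extChartAt 𝓘(ℝ, E) x x)) = f x := by
    rw [extChartAt_to_inv]
  have hfd : ∀ y, MDifferentiableAt 𝓘(ℝ, E) 𝓘(ℝ, F) f y := hf.mdifferentiable (by simp)
  have hψ : ∀ z ∈ (extChartAt 𝓘(ℝ, E) x).target,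
      MDifferentiableAt 𝓘(ℝ, E) 𝓘(ℝ, E) (extChartAt 𝓘(ℝ, E) x).symm z := fun z hz => by
    have h := mdifferentiableWithinAt_extChartAt_symm hz
    rwa [ModelWithCorners.range_eq_univ, mdifferentiableWithinAt_univ] at h
  have hinv : ∀ z ∈ (extChartAt 𝓘(ℝ, E) x).target,
      (mfderiv 𝓘(ℝ, E) 𝓘(ℝ, E) (extChartAt 𝓘(ℝ, E) x).symm z).IsInvertible := fun z hz => by
    have h := isInvertible_mfderivWithin_extChartAt_symm hz
    rwa [ModelWithCorners.range_eq_univ, mfderivWithin_univ] at h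
  have hg : ContDiffAt ℝ 2 (f ∘ (extChartAt 𝓘(ℝ, E) x).symm) (extChartAt 𝓘(ℝ, E) x x) := by
    rw [← contMDiffAt_iff_contDiffAt]
    refine (hf.contMDiffAt.of_le (by norm_cast)).comp _ ?_
    have h := contMDiffWithinAt_extChartAt_symm_range_self (n := 2) (I := 𝓘(ℝ, E)) x
    rwa [ModelWithCorners.range_eq_univ, contMDiffWithinAt_univ] at h
  have hchain : ∀ z ∈ (extChartAt 𝓘(ℝ, E) x).target, ∀ u : E,
      fderiv ℝ (f ∘ (extChartAt 𝓘(ℝ, E) x).symm) z u =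
        mfderiv 𝓘(ℝ, E) 𝓘(ℝ, F) f ((extChartAt 𝓘(ℝ, E) x).symm z)
          (mfderiv 𝓘(ℝ, E) 𝓘(ℝ, E) (extChartAt 𝓘(ℝ, E) x).symm z u) := fun z hz u => by
    rw [← mfderiv_eq_fderiv, mfderiv_comp z (hfd _) (hψ z hz)]
    rfl
  -- the coordinate expression of a vector field on `M` in the chart at `x`
  let pb : (Π y : M, TangentSpace 𝓘(ℝ, E) y) → E → E := fun U =>
    mpullback 𝓘(ℝ, E) 𝓘(ℝ, E) (extChartAt 𝓘(ℝ, E) x).symm U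
  have hrel : ∀ {U : Π y : M, TangentSpace 𝓘(ℝ, E) y} {U' : F → F},
      (∀ y, mfderiv 𝓘(ℝ, E) 𝓘(ℝ, F) f y (U y) = U' (f y)) →
      ∀ᶠ z in 𝓝 (extChartAt 𝓘(ℝ, E) x x), fderiv ℝ (f ∘ (extChartAt 𝓘(ℝ, E) x).symm) z
        (pb U z) = U' ((f ∘ (extChartAt 𝓘(ℝ, E) x).symm) z) := by
    intro U U' hU
    filter_upwards [extChartAt_target_mem_nhds (I := 𝓘(ℝ, E)) x] with z hz
    refine (hchain z hz _).trans (Eq.trans ?_ (hU _))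
    exact congrArg _ ((hinv z hz).self_apply_inverse _)
  have hdiff : ∀ {U : Π y : M, TangentSpace 𝓘(ℝ, E) y},
      ContMDiffAt 𝓘(ℝ, E) 𝓘(ℝ, E).tangent 1 (fun y => (U y : TangentBundle 𝓘(ℝ, E) M)) x →
      DifferentiableAt ℝ (pb U) (extChartAt 𝓘(ℝ, E) x x) := by
    intro U hU
    have h := (hU.mdifferentiableAt one_ne_zero).mdifferentiableWithinAt
      (s := Set.univ) |>.differentiableWithinAt_mpullbackWithin_vectorField
    rw [ModelWithCorners.range_eq_univ, mpullbackWithin_univ, Set.preimage_univ,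
      Set.inter_univ] at h
    exact differentiableWithinAt_univ.1 h
  have key := fderiv_lieBracket_of_related hg (hdiff hV) (hdiff hW)
    (V' := V') (W' := W') (by rwa [Function.comp_apply, hfx]) (by rwa [Function.comp_apply, hfx])
    (hrel hVV') (hrel hWW')
  rw [Function.comp_apply, hfx] at key
  rw [← key]
  have hbr : mlieBracket 𝓘(ℝ, E) V W x = (mfderiv 𝓘(ℝ, E) 𝓘(ℝ, E) (extChartAt 𝓘(ℝ, E) x) x).inverse
      (lieBracket (E := E) ℝ (pb V) (pb W) (extChartAt 𝓘(ℝ, E) x x)) := by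
    rw [← mlieBracketWithin_univ, mlieBracketWithin_apply,
      ModelWithCorners.range_eq_univ, mpullbackWithin_univ, mpullbackWithin_univ,
      Set.preimage_univ, Set.inter_univ]
    exact congrArg _ (congrFun lieBracketWithin_univ _)
  generalize lieBracket ℝ (pb V) (pb W) (extChartAt 𝓘(ℝ, E) x x) = u at hbr ⊢
  -- `f = (f ∘ φ⁻¹) ∘ φ` near `x`
  have hev : f =ᶠ[𝓝 x] (f ∘ (extChartAt 𝓘(ℝ, E) x).symm) ∘ extChartAt 𝓘(ℝ, E) x := by
    filter_upwards [extChartAt_source_mem_nhds (I := 𝓘(ℝ, E)) x] with y hy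
    simp only [Function.comp_apply, (extChartAt 𝓘(ℝ, E) x).left_inv hy]
  rw [hbr, hev.mfderiv_eq, mfderiv_comp x
    (hg.differentiableAt (by norm_num)).mdifferentiableAt
    (mdifferentiableAt_extChartAt (mem_chart_source E x)), mfderiv_eq_fderiv]
  exact congrArg (fderiv ℝ (f ∘ (extChartAt 𝓘(ℝ, E) x).symm) (extChartAt 𝓘(ℝ, E) x x))
    ((isInvertible_mfderiv_extChartAt hsrc).self_apply_inverse u)

end Manifold

/-! ### Curves in the image of an immersion -/

/-- If a continuous curve `x` is mapped by an immersion `f` to a curve with velocity `Y`, then `Y`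
is tangent to the image of the immersion: differentiability of `x` need not be assumed. -/
theorem exists_eq_of_hasDerivAt_comp {E F : Type*} [NormedAddCommGroup E] [NormedSpace ℝ E]
    [FiniteDimensional ℝ E] [NormedAddCommGroup F] [NormedSpace ℝ F] {f : E → F} {L : E →L[ℝ] F}
    {x : ℝ → E} (hf : HasFDerivAt f L (x 0)) (hL : Function.Injective L) (hx : ContinuousAt x 0)
    {Y : F} (hY : HasDerivAt (fun t => f (x t)) Y 0) : ∃ v, L v = Y := by
  obtain ⟨C, -, hC⟩ := (L : E →ₗ[ℝ] F).exists_antilipschitzWith (LinearMap.ker_eq_bot.2 hL)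
  have he : (fun t => f (x t) - f (x 0) - L (x t - x 0)) =o[𝓝 0] fun t => x t - x 0 :=
    hf.isLittleO.comp_tendsto hx
  -- `L` is bounded below, so `x t - x 0` is controlled by `f (x t) - f (x 0)`, which is `O(t)`
  have hyL : (fun t => x t - x 0) =O[𝓝 0] fun t => L (x t - x 0) :=
    Asymptotics.IsBigO.of_bound C (Eventually.of_forall fun t => by
      simpa using hC.le_mul_dist (x t - x 0) 0)
  have hyd : (fun t => x t - x 0) =O[𝓝 0] fun t => f (x t) - f (x 0) := by
    have h := hyL.trans (he.trans_isBigO hyL).right_isBigO_add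
    simpa using h
  have hd : (fun t => f (x t) - f (x 0)) =O[𝓝 0] fun t : ℝ => t := by
    simpa using hY.isBigO_sub
  have h1 : (fun t => f (x t) - f (x 0) - t • Y) =o[𝓝 0] fun t : ℝ => t := by
    simpa using hY.isLittleO
  have h2 : (fun t => L (x t - x 0) - t • Y) =o[𝓝 0] fun t : ℝ => t := by
    have h := h1.sub (he.trans_isBigO (hyd.trans hd))
    refine h.congr_left fun t => ?_
    abel
  -- `Y` is a limit of vectors in the range of `L`, which is closed by finite dimensionality
  have h3 : Tendsto (fun t : ℝ => L (t⁻¹ • (x t - x 0))) (𝓝[≠] 0) (𝓝 Y) := by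
    have h : Tendsto (fun t : ℝ => t⁻¹ • (L (x t - x 0) - t • Y) + Y) (𝓝[≠] 0) (𝓝 (0 + Y)) :=
      (h2.tendsto_inv_smul_nhds_zero.mono_left nhdsWithin_le_nhds).add tendsto_const_nhds
    rw [zero_add] at h
    refine h.congr' ?_
    filter_upwards [self_mem_nhdsWithin] with t ht
    rw [smul_sub, inv_smul_smul₀ ht, sub_add_cancel, map_smul]
  have hclosed : IsClosed ((LinearMap.range (L : E →ₗ[ℝ] F) : Submodule ℝ F) : Set F) :=
    Submodule.closed_of_finiteDimensional _
  exact hclosed.mem_of_tendsto h3 (Eventually.of_forall fun t => ⟨_, rfl⟩)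

/-! ### Smooth homomorphisms from a Lie group to a normed algebra -/

section LieGroupHom

variable {k : ℕ} {K : Type*} [TopologicalSpace K] [ChartedSpace (EuclideanSpace ℝ (Fin k)) K]
  [Group K]
  {A : Type*} [NormedRing A] [NormedAlgebra ℝ A] {φ : K →* A}

variable (k) in
/-- The differential at the identity of a homomorphism from a Lie group to the multiplicative monoid
of a normed algebra, whose tangent space at `φ 1` is identified with the algebra itself. -/
def homDeriv (φ : K →* A) : GroupLieAlgebra (𝓡 k) K →L[ℝ] A :=
  mfderiv (𝓡 k) 𝓘(ℝ, A) φ 1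

/-- If a continuous curve is mapped by an immersive homomorphism to a one-parameter group, then the
generator of this one-parameter group lies in the image of the Lie algebra. -/
theorem mem_range_homDeriv [CompleteSpace A] (hφ : ContMDiff (𝓡 k) 𝓘(ℝ, A) ∞ φ)
    (hinj : Function.Injective (homDeriv k φ)) {c : ℝ → K} (hc : ContinuousAt c 0) (h0 : c 0 = 1)
    {X : A} (hX : ∀ t, φ (c t) = NormedSpace.exp (t • X)) : ∃ v, homDeriv k φ v = X := by
  obtain ⟨L, hLφ, hL⟩ : ∃ L : EuclideanSpace ℝ (Fin k) →L[ℝ] A, (∀ v, L v = homDeriv k φ v) ∧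
      HasFDerivAt (φ ∘ (extChartAt (𝓡 k) (1 : K)).symm) L (extChartAt (𝓡 k) (1 : K) (c 0)) := by
    refine ⟨homDeriv k φ, fun _ => rfl, ?_⟩
    have h := (hφ.mdifferentiable (by simp) 1).hasMFDerivAt.2
    rw [ModelWithCorners.range_eq_univ] at h
    rw [h0]
    exact hasFDerivWithinAt_univ.1 h
  have hLinj : Function.Injective L := fun a b hab => hinj (by rwa [hLφ, hLφ] at hab)
  have hx : ContinuousAt (fun t => extChartAt (𝓡 k) (1 : K) (c t)) 0 := by
    refine ContinuousAt.comp (f := c) ?_ hc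
    rw [h0]
    exact continuousAt_extChartAt 1
  have hY : HasDerivAt
      (fun t => (φ ∘ (extChartAt (𝓡 k) (1 : K)).symm) (extChartAt (𝓡 k) (1 : K) (c t))) X 0 := by
    have h := hasDerivAt_exp_smul_const (𝕂 := ℝ) X 0
    rw [zero_smul, NormedSpace.exp_zero, one_mul] at h
    refine h.congr_of_eventuallyEq ?_
    have hsrc : ∀ᶠ t in 𝓝 (0 : ℝ), c t ∈ (extChartAt (𝓡 k) (1 : K)).source :=
      hc.eventually_mem (h0 ▸ extChartAt_source_mem_nhds (I := 𝓡 k) (1 : K))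
    filter_upwards [hsrc] with t ht
    rw [← hX t, Function.comp_apply, (extChartAt (𝓡 k) (1 : K)).left_inv ht]
  obtain ⟨v, hv⟩ := exists_eq_of_hasDerivAt_comp
    (x := fun t => extChartAt (𝓡 k) (1 : K) (c t)) hL hLinj hx hY
  exact ⟨v, (hLφ v).symm.trans hv⟩

variable [LieGroup (𝓡 k) ∞ K]

/-- A smooth homomorphism `φ` relates the left invariant vector field of `v` to the vector field
`a ↦ a * φ_* v`. -/
theorem mfderiv_hom_mulInvariantVectorField (hφ : ContMDiff (𝓡 k) 𝓘(ℝ, A) ∞ φ)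
    (v : GroupLieAlgebra (𝓡 k) K) (g : K) :
    mfderiv (𝓡 k) 𝓘(ℝ, A) φ g (mulInvariantVectorField v g) = φ g * homDeriv k φ v := by
  have hfd : ∀ y, MDifferentiableAt (𝓡 k) 𝓘(ℝ, A) φ y := hφ.mdifferentiable (by simp)
  have hmul : MDifferentiableAt (𝓡 k) (𝓡 k) (fun x : K => g * x) 1 :=
    (contMDiff_mul_left (I := 𝓡 k) (n := ∞)).mdifferentiable (by simp) 1
  have h1 : mfderiv (𝓡 k) 𝓘(ℝ, A) (φ ∘ fun x => g * x) 1 =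
      (mfderiv (𝓡 k) 𝓘(ℝ, A) φ (g * 1)).comp (mfderiv (𝓡 k) (𝓡 k) (fun x => g * x) 1) :=
    mfderiv_comp 1 (hfd _) hmul
  have h2 : (φ ∘ fun x => g * x) = (fun a => ContinuousLinearMap.mul ℝ A (φ g) a) ∘ φ := by
    ext x
    simp
  have h3 : mfderiv (𝓡 k) 𝓘(ℝ, A) ((fun a => ContinuousLinearMap.mul ℝ A (φ g) a) ∘ φ) 1 =
      (mfderiv 𝓘(ℝ, A) 𝓘(ℝ, A) (fun a => ContinuousLinearMap.mul ℝ A (φ g) a) (φ 1)).comp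
        (mfderiv (𝓡 k) 𝓘(ℝ, A) φ 1) :=
    mfderiv_comp 1 (ContinuousLinearMap.mdifferentiableAt _) (hfd _)
  rw [h2, h3, mul_one, ContinuousLinearMap.mfderiv_eq] at h1
  exact (DFunLike.congr_fun h1 v).symm

/-- The differential of a smooth homomorphism is compatible with the brackets. -/
theorem homDeriv_bracket (hφ : ContMDiff (𝓡 k) 𝓘(ℝ, A) ∞ φ) (v w : GroupLieAlgebra (𝓡 k) K) :
    homDeriv k φ ⁅v, w⁆ = homDeriv k φ v * homDeriv k φ w - homDeriv k φ w * homDeriv k φ v := by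
  have hc : ∀ u : GroupLieAlgebra (𝓡 k) K, ContMDiffAt (𝓡 k) (𝓡 k).tangent 1
      (fun y => (mulInvariantVectorField u y : TangentBundle (𝓡 k) K)) 1 := fun u =>
    (contMDiffAt_mulInvariantVectorField u).of_le
      ((by norm_num : (1 : WithTop ℕ∞) ≤ 2).trans le_minSmoothness)
  have hd : ∀ X : A,
      HasFDerivAt (fun a : A => a * X) ((ContinuousLinearMap.mul ℝ A).flip X) (φ 1) :=
    fun X => ((ContinuousLinearMap.mul ℝ A).flip X).hasFDerivAt
  have h := mfderiv_mlieBracket_of_related hφ (hc v) (hc w)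
    (V' := fun a => a * homDeriv k φ v) (W' := fun a => a * homDeriv k φ w)
    (hd _).differentiableAt (hd _).differentiableAt
    (mfderiv_hom_mulInvariantVectorField hφ v) (mfderiv_hom_mulInvariantVectorField hφ w)
  rw [lieBracket_eq] at h
  simp only [fun X => (hd X).fderiv] at h
  simp only [ContinuousLinearMap.flip_apply, ContinuousLinearMap.mul_apply', map_one,
    one_mul] at h
  exact h

/-- The integral curve of a left invariant vector field through `1` is mapped by a smooth
homomorphism `φ`, for small times, to the one-parameter group of the corresponding element of the
algebra. -/
theorem exists_curve_hom_eq_exp [CompleteSpace A] (hφ : ContMDiff (𝓡 k) 𝓘(ℝ, A) ∞ φ)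
    (v : GroupLieAlgebra (𝓡 k) K) : ∃ γ : ℝ → K, γ 0 = 1 ∧
      HasMFDerivAt 𝓘(ℝ, ℝ) (𝓡 k) γ 0 ((1 : ℝ →L[ℝ] ℝ).smulRight (mulInvariantVectorField v (γ 0))) ∧
      ∀ᶠ t in 𝓝 (0 : ℝ), φ (γ t) = NormedSpace.exp (t • homDeriv k φ v) := by
  have hc : ContMDiffAt (𝓡 k) (𝓡 k).tangent 1
      (fun y => (mulInvariantVectorField v y : TangentBundle (𝓡 k) K)) 1 :=
    (contMDiffAt_mulInvariantVectorField v).of_le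
      ((by norm_num : (1 : WithTop ℕ∞) ≤ 2).trans le_minSmoothness)
  have : IsManifold (𝓡 k) 1 K := IsManifold.of_le (n := ∞) (by simp)
  obtain ⟨γ, h0, hγ⟩ := exists_isMIntegralCurveAt_of_contMDiffAt_boundaryless 0 hc
  refine ⟨γ, h0, hγ.hasMFDerivAt, ?_⟩
  obtain ⟨ε, hε, hball⟩ := Metric.eventually_nhds_iff_ball.1 hγ
  have hder : ∀ t ∈ Metric.ball (0 : ℝ) ε,
      HasDerivAt (fun s => φ (γ s)) (φ (γ t) * homDeriv k φ v) t := by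
    intro t ht
    have h := ((hφ.mdifferentiable (by simp) (γ t)).hasMFDerivAt).comp t (hball t ht)
    obtain ⟨L, hL, hL1⟩ : ∃ L : ℝ →L[ℝ] A, HasFDerivAt (fun s => φ (γ s)) L t ∧
        L 1 = φ (γ t) * homDeriv k φ v := by
      refine ⟨_, hasMFDerivAt_iff_hasFDerivAt.1 h, ?_⟩
      rw [← mfderiv_hom_mulInvariantVectorField hφ]
      change mfderiv (𝓡 k) 𝓘(ℝ, A) φ (γ t) ((1 : ℝ) • mulInvariantVectorField v (γ t)) = _
      rw [one_smul]
    exact hL.hasDerivAt.congr_deriv hL1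
  have hder2 : ∀ t ∈ Metric.ball (0 : ℝ) ε,
      HasDerivAt (fun s => φ (γ s) * NormedSpace.exp (s • -homDeriv k φ v)) 0 t := by
    intro t ht
    refine ((hder t ht).mul
      (hasDerivAt_exp_smul_const' (𝕂 := ℝ) (-homDeriv k φ v) t)).congr_deriv ?_
    rw [mul_assoc, ← mul_add, ← add_mul, add_neg_cancel, zero_mul, mul_zero]
  filter_upwards [Metric.ball_mem_nhds 0 hε] with t ht
  have hconst : φ (γ t) * NormedSpace.exp (t • -homDeriv k φ v) = 1 := by
    have h := Metric.isOpen_ball.is_const_of_deriv_eq_zero (convex_ball (0 : ℝ) ε).isPreconnected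
      (fun s hs => (hder2 s hs).differentiableAt.differentiableWithinAt)
      (fun s hs => (hder2 s hs).deriv) ht (Metric.mem_ball_self hε)
    simpa [h0] using h
  let _ : NormedAlgebra ℚ A := NormedAlgebra.restrictScalars ℚ ℝ A
  have hexp : NormedSpace.exp (t • -homDeriv k φ v) * NormedSpace.exp (t • homDeriv k φ v) = 1 := by
    rw [smul_neg, ← NormedSpace.exp_add_of_commute (Commute.refl _).neg_left, neg_add_cancel,
      NormedSpace.exp_zero]
  rw [← mul_one (φ (γ t)), ← hexp, ← mul_assoc, hconst, one_mul]

/-- The differential of an injective smooth homomorphism is injective: if it kills `v`, the integral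
curve of `v` through `1` has constant image, hence is constant. -/
theorem homDeriv_injective [CompleteSpace A] (hφ : ContMDiff (𝓡 k) 𝓘(ℝ, A) ∞ φ)
    (hinj : Function.Injective φ) : Function.Injective (homDeriv k φ) := by
  rw [injective_iff_map_eq_zero]
  intro v hv
  obtain ⟨γ, h0, hγ, hexp⟩ := exists_curve_hom_eq_exp hφ v
  have hconst : γ =ᶠ[𝓝 0] fun _ => 1 := by
    filter_upwards [hexp] with t ht
    rw [hv, smul_zero, NormedSpace.exp_zero, ← map_one φ] at ht
    exact hinj ht
  have h1 := hasMFDerivAt_unique hγ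
    ((hasMFDerivAt_const (1 : K) (0 : ℝ)).congr_of_eventuallyEq hconst)
  have h2 : mulInvariantVectorField v (γ 0) = 0 := by
    have h : (1 : ℝ) • mulInvariantVectorField v (γ 0) = 0 := DFunLike.congr_fun h1 (1 : ℝ)
    rwa [one_smul] at h
  have h3 : ∀ g : K, g = 1 → mulInvariantVectorField v g = 0 → v = 0 := by
    rintro g rfl hg
    have hid : (fun x : K => 1 * x) = id := by
      ext x
      simp
    rw [mulInvariantVectorField, hid, mfderiv_id] at hg
    exact hg
  exact h3 _ h0 h2

/-- For large `n`, the element `exp (φ_* v / n)` lies in the image of `φ`, hence so does its power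
`exp (φ_* v)`. -/
theorem exp_homDeriv_mem_range [CompleteSpace A] (hφ : ContMDiff (𝓡 k) 𝓘(ℝ, A) ∞ φ)
    (v : GroupLieAlgebra (𝓡 k) K) : NormedSpace.exp (homDeriv k φ v) ∈ Set.range φ := by
  obtain ⟨γ, -, -, hexp⟩ := exists_curve_hom_eq_exp hφ v
  have hlim : Tendsto (fun n : ℕ => ((n : ℝ))⁻¹) atTop (𝓝 0) := tendsto_inv_atTop_nhds_zero_nat
  obtain ⟨n, hn, hn0⟩ := ((hlim.eventually hexp).and (eventually_ne_atTop 0)).exists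
  refine ⟨γ (n : ℝ)⁻¹ ^ n, ?_⟩
  let _ : NormedAlgebra ℚ A := NormedAlgebra.restrictScalars ℚ ℝ A
  rw [map_pow, hn, ← NormedSpace.exp_nsmul, ← Nat.cast_smul_eq_nsmul ℝ, smul_smul,
    mul_inv_cancel₀ (by exact_mod_cast hn0), one_smul]

end LieGroupHom

/-! ### The group `SO(V)` and exponentials of skew-adjoint operators -/

section SpecialOrthogonal

variable {V : Type*} [NormedAddCommGroup V] [InnerProductSpace ℝ V] [CompleteSpace V]

/-- The inclusion of `SO(V)` into `End V` as a monoid homomorphism. -/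
def SO.toEndHom : SO V →* (V →L[ℝ] V) :=
  (unitary (V →L[ℝ] V)).subtype.comp (SO V).subtype

theorem SO.toEnd_injective : Function.Injective (SO.toEnd : SO V → V →L[ℝ] V) :=
  Subtype.val_injective.comp Subtype.val_injective

theorem SO.toEnd_mul (g h : SO V) : SO.toEnd (g * h) = SO.toEnd g * SO.toEnd h := rfl

theorem SO.toEnd_one : SO.toEnd (1 : SO V) = 1 := rfl

theorem SO.toEnd_inv_apply (g : SO V) (p : V) : SO.toEnd g (SO.toEnd g⁻¹ p) = p := by
  rw [← mul_apply_eq_comp, ← SO.toEnd_mul, mul_inv_cancel, SO.toEnd_one,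
    one_apply_eq_self]

theorem SO.isInducing_toEnd : IsInducing (SO.toEnd : SO V → V →L[ℝ] V) :=
  IsInducing.subtypeVal.comp IsInducing.subtypeVal

theorem SO.continuous_toEnd : Continuous (SO.toEnd : SO V → V →L[ℝ] V) :=
  SO.isInducing_toEnd.continuous

theorem SO.range_toEnd : Set.range (SO.toEnd : SO V → V →L[ℝ] V) =
    {A | A ∈ unitary (V →L[ℝ] V) ∧ A.det = 1} := by
  ext A
  constructor
  · rintro ⟨g, rfl⟩
    exact ⟨g.1.2, g.2⟩
  · rintro ⟨h1, h2⟩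
    exact ⟨⟨⟨A, h1⟩, h2⟩, rfl⟩

theorem SO.isClosedEmbedding_toEnd [FiniteDimensional ℝ V] :
    IsClosedEmbedding (SO.toEnd : SO V → V →L[ℝ] V) := by
  refine ⟨⟨SO.isInducing_toEnd, SO.toEnd_injective⟩, ?_⟩
  rw [SO.range_toEnd]
  refine IsClosed.inter isClosed_unitary (isClosed_eq ?_ continuous_const)
  exact ContinuousLinearMap.continuous_det

theorem det_sq_eq_one_of_mem_unitary [FiniteDimensional ℝ V] {U : V →L[ℝ] V}
    (hU : U ∈ unitary (V →L[ℝ] V)) : U.det ^ 2 = 1 := by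
  have h := ContinuousLinearMap.normDet_sq U
  have h1 : ContinuousLinearMap.adjoint U ∘L U = ContinuousLinearMap.id ℝ V := by
    have h2 := (Unitary.mem_iff.1 hU).1
    exact h2
  rw [h1, LinearMap.normDet_eq_norm_det, Real.norm_eq_abs, sq_abs] at h
  refine Eq.trans ?_ (h.trans ?_)
  · rfl
  · exact LinearMap.det_id

/-- The exponential of a skew-adjoint operator lies in `SO(V)`. -/
theorem exists_toEnd_eq_exp [FiniteDimensional ℝ V] {X : V →L[ℝ] V}
    (hX : X ∈ skewAdjoint (V →L[ℝ] V)) : ∃ g : SO V, SO.toEnd g = NormedSpace.exp X := by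
  let _ : NormedAlgebra ℚ (V →L[ℝ] V) := NormedAlgebra.restrictScalars ℚ ℝ (V →L[ℝ] V)
  have hunit : ∀ Y ∈ skewAdjoint (V →L[ℝ] V), NormedSpace.exp Y ∈ unitary (V →L[ℝ] V) :=
    fun Y hY => NormedSpace.exp_mem_unitary_of_mem_skewAdjoint hY
  have hhalf : (2⁻¹ : ℝ) • X ∈ skewAdjoint (V →L[ℝ] V) := skewAdjoint.smul_mem _ hX
  -- `exp X` is the square of the orthogonal operator `exp (X / 2)`, whose determinant is `±1`
  have hsq : NormedSpace.exp X =
      NormedSpace.exp ((2⁻¹ : ℝ) • X) * NormedSpace.exp ((2⁻¹ : ℝ) • X) := by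
    rw [← NormedSpace.exp_add_of_commute (Commute.refl _), ← add_smul]
    norm_num
  have hdet : (NormedSpace.exp X).det = 1 := by
    rw [← det_sq_eq_one_of_mem_unitary (hunit _ hhalf), hsq, sq]
    exact LinearMap.det_comp _ _
  exact ⟨⟨⟨_, hunit X hX⟩, hdet⟩, rfl⟩

end SpecialOrthogonal

/-! ### Quaternionic structures -/

section QuaternionicStructure

variable {V : Type*} [NormedAddCommGroup V] [InnerProductSpace ℝ V] [CompleteSpace V]

/-- A quaternionic structure is the image of the imaginary quaternions under an algebra
homomorphism. -/
theorem IsQuaternionicStructure.exists_algHom [Nontrivial V] {q : Submodule ℝ (V →L[ℝ] V)}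
    (hq : IsQuaternionicStructure q) : ∃ Φ : ℍ[ℝ] →ₐ[ℝ] (V →L[ℝ] V),
      imQuaternion.toSubmodule.map Φ.toLinearMap = q := by
  obtain ⟨-, hrank, J, hJ, hsq, hmul⟩ := hq
  have : FiniteDimensional ℝ q := FiniteDimensional.of_finrank_pos (by lia)
  refine ⟨quaternionLift J hsq hmul, Submodule.eq_of_le_of_finrank_eq ?_ ?_⟩
  · rintro _ ⟨x, hx, rfl⟩
    have hx0 : x.re = 0 := hx
    rw [AlgHom.toLinearMap_apply, quaternionLift_apply, hx0, map_zero, zero_add]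
    exact q.add_mem (q.add_mem (q.smul_mem _ (hJ 0)) (q.smul_mem _ (hJ 1))) (q.smul_mem _ (hJ 2))
  · rw [hrank, ← finrank_imQuaternion]
    exact (Submodule.equivMapOfInjective _ (Quaternion.algHom_injective _) _).symm.finrank_eq

variable [FiniteDimensional ℝ V] {q : Submodule ℝ (V →L[ℝ] V)} {Φ : ℍ[ℝ] →ₐ[ℝ] (V →L[ℝ] V)}

theorem exists_toEnd_eq_of_norm_eq_one (hq : q ≤ skewAdjoint.submodule ℝ (V →L[ℝ] V))
    (hΦ : imQuaternion.toSubmodule.map Φ.toLinearMap = q) {u : ℍ[ℝ]} (hu : ‖u‖ = 1) :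
    ∃ g ∈ connectedSubgroup q, SO.toEnd g = Φ u := by
  obtain ⟨x, hx, rfl⟩ := exists_imQuaternion_exp_eq hu
  have hxq : Φ x ∈ q := hΦ ▸ ⟨x, hx, rfl⟩
  obtain ⟨g, hg⟩ := exists_toEnd_eq_exp (hq hxq)
  exact ⟨g, Subgroup.subset_closure ⟨_, hxq, hg⟩, by rw [hg, Quaternion.algHom_exp]⟩

/-- The connected group with Lie algebra `q = Φ (Im ℍ)` is the image under `Φ` of the unit
quaternions. -/
theorem mem_connectedSubgroup_iff (hq : q ≤ skewAdjoint.submodule ℝ (V →L[ℝ] V))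
    (hΦ : imQuaternion.toSubmodule.map Φ.toLinearMap = q) {g : SO V} :
    g ∈ connectedSubgroup q ↔ ∃ u : ℍ[ℝ], ‖u‖ = 1 ∧ SO.toEnd g = Φ u := by
  constructor
  · intro hg
    induction hg using Subgroup.closure_induction with
    | mem g hg =>
      obtain ⟨X, hX, hgX⟩ := hg
      rw [← hΦ] at hX
      obtain ⟨x, hx, rfl⟩ := hX
      exact ⟨NormedSpace.exp x, norm_exp_imQuaternion hx, by
        rw [hgX, Quaternion.algHom_exp]; rfl⟩
    | one => exact ⟨1, norm_one, by rw [map_one]; rfl⟩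
    | mul g h _ _ hg hh =>
      obtain ⟨u, hu, hgu⟩ := hg
      obtain ⟨w, hw, hhw⟩ := hh
      exact ⟨u * w, by rw [norm_mul, hu, hw, one_mul], by rw [SO.toEnd_mul, hgu, hhw, map_mul]⟩
    | inv g _ hg =>
      obtain ⟨u, hu, hgu⟩ := hg
      have hu0 : u ≠ 0 := norm_ne_zero_iff.1 (by rw [hu]; exact one_ne_zero)
      refine ⟨u⁻¹, by rw [norm_inv, hu, inv_one], ?_⟩
      have h1 : SO.toEnd g⁻¹ * SO.toEnd g = 1 := by rw [← SO.toEnd_mul, inv_mul_cancel]; rfl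
      have h2 : Φ u * Φ u⁻¹ = 1 := by rw [← map_mul, mul_inv_cancel₀ hu0, map_one]
      rw [hgu] at h1
      exact left_inv_eq_right_inv h1 h2
  · rintro ⟨u, hu, hgu⟩
    obtain ⟨h, hh, hhu⟩ := exists_toEnd_eq_of_norm_eq_one hq hΦ hu
    rwa [SO.toEnd_injective (hgu.trans hhu.symm)]

/-- The isomorphism from the group of unit quaternions to the connected subgroup of `SO(V)` with Lie
algebra `q`. -/
theorem exists_unitQuaternion_equiv [Nontrivial V] (hq : q ≤ skewAdjoint.submodule ℝ (V →L[ℝ] V))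
    (hΦ : imQuaternion.toSubmodule.map Φ.toLinearMap = q) :
    ∃ e : Metric.sphere (0 : ℍ[ℝ]) 1 ≃* connectedSubgroup q, ∀ u, SO.toEnd (e u : SO V) = Φ u := by
  choose f hf hfΦ using fun u : Metric.sphere (0 : ℍ[ℝ]) 1 =>
    exists_toEnd_eq_of_norm_eq_one hq hΦ (mem_sphere_zero_iff_norm.1 u.2)
  let e : Metric.sphere (0 : ℍ[ℝ]) 1 →* connectedSubgroup q :=
    MonoidHom.mk' (fun u => ⟨f u, hf u⟩) fun u w => Subtype.ext (SO.toEnd_injective (by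
      rw [Subgroup.coe_mul, SO.toEnd_mul, hfΦ, hfΦ, hfΦ, Metric.unitSphere.coe_mul, map_mul]))
  refine ⟨MulEquiv.ofBijective e ⟨?_, ?_⟩, hfΦ⟩
  · intro u w huw
    apply Subtype.ext
    apply Quaternion.algHom_injective Φ
    rw [← hfΦ, ← hfΦ]
    exact congrArg (fun g : connectedSubgroup q => SO.toEnd (g : SO V)) huw
  · rintro ⟨g, hg⟩
    obtain ⟨u, hu, hgu⟩ := (mem_connectedSubgroup_iff hq hΦ).1 hg
    exact ⟨⟨u, mem_sphere_zero_iff_norm.2 hu⟩,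
      Subtype.ext (SO.toEnd_injective ((hfΦ _).trans hgu.symm))⟩

theorem isConnected_connectedSubgroup [Nontrivial V]
    (hq : q ≤ skewAdjoint.submodule ℝ (V →L[ℝ] V))
    (hΦ : imQuaternion.toSubmodule.map Φ.toLinearMap = q) :
    IsConnected (connectedSubgroup q : Set (SO V)) := by
  obtain ⟨e, he⟩ := exists_unitQuaternion_equiv hq hΦ
  have hconn : IsConnected (Metric.sphere (0 : ℍ[ℝ]) 1) := by
    refine isConnected_sphere ?_ 0 zero_le_one
    rw [← Module.finrank_eq_rank, Quaternion.finrank_eq_four]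
    norm_num
  have : ConnectedSpace (Metric.sphere (0 : ℍ[ℝ]) 1) := isConnected_iff_connectedSpace.1 hconn
  have hcont : Continuous fun u => (e u : SO V) := by
    rw [SO.isInducing_toEnd.continuous_iff]
    have h : (SO.toEnd ∘ fun u => (e u : SO V)) = fun u : Metric.sphere (0 : ℍ[ℝ]) 1 => Φ u :=
      funext he
    rw [h]
    exact (Quaternion.algHom_continuous Φ).comp continuous_subtype_val
  have hrange : Set.range (fun u => (e u : SO V)) = connectedSubgroup q := by
    rw [Set.range_comp' Subtype.val e, e.surjective.range_eq, Set.image_univ, Subtype.range_val]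
  rw [← hrange]
  exact isConnected_range hcont

end QuaternionicStructure

/-! ### Subgroups of `SO(V)` leaving the leaves of a foliation invariant -/

section Foliation

variable {V : Type*} [NormedAddCommGroup V] [InnerProductSpace ℝ V] [CompleteSpace V]
  {F : SphereFoliation V}

theorem leavesInvariant_of_mapsTo {H : Subgroup (SO V)}
    (h : ∀ g ∈ H, ∀ i, ∀ p ∈ (F.leaf i).points, SO.toEnd g p ∈ (F.leaf i).points) :
    LeavesInvariant F H := by
  intro g hg i
  refine Set.Subset.antisymm ?_ fun p hp => ?_
  · rintro _ ⟨p, hp, rfl⟩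
    exact h g hg i p hp
  · exact ⟨SO.toEnd g⁻¹ p, h _ (H.inv_mem hg) i p hp, SO.toEnd_inv_apply g p⟩

theorem PreservesFoliation.leavesInvariant {q : Submodule ℝ (V →L[ℝ] V)}
    (h : PreservesFoliation F q) : LeavesInvariant F (connectedSubgroup q) :=
  leavesInvariant_of_mapsTo fun g hg i p hp => h p (F.leaf_subset i hp) i hp g hg

theorem LeavesInvariant.preservesFoliation {q : Submodule ℝ (V →L[ℝ] V)} {H : Subgroup (SO V)}
    (h : LeavesInvariant F H) (hq : connectedSubgroup q ≤ H) : PreservesFoliation F q :=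
  fun _ _ i hp g hg => h g (hq hg) i ▸ Set.mem_image_of_mem _ hp

/-- When the leaves are closed, the maximal connected group leaving them invariant is closed,
because its closure is also connected and leaves them invariant. -/
theorem IsMaximalConnectedInvariant.isClosed (hF : F.IsClosedFoliation) {H : Subgroup (SO V)}
    (hH : IsMaximalConnectedInvariant F H) : IsClosed (H : Set (SO V)) := by
  have hmem : H.topologicalClosure ∈
      {H : Subgroup (SO V) | IsConnected (H : Set (SO V)) ∧ LeavesInvariant F H} := by
    refine ⟨hH.1.1.closure, leavesInvariant_of_mapsTo fun g hg i p hp => ?_⟩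
    have hcont : Continuous fun h : SO V => SO.toEnd h p :=
      (ContinuousLinearMap.apply ℝ V p).continuous.comp SO.continuous_toEnd
    exact closure_minimal (fun h hh => hH.1.2 h hh i ▸ Set.mem_image_of_mem _ hp)
      ((hF i).preimage hcont) hg
  have h := le_antisymm (hH.2 hmem) H.le_topologicalClosure
  rw [← h]
  exact H.isClosed_topologicalClosure

end Foliation

/-! ### Representations with closed image -/

section Representation

variable {k : ℕ} {K : Type*} [TopologicalSpace K] [ChartedSpace (EuclideanSpace ℝ (Fin k)) K]
  [Group K] {V : Type*} [NormedAddCommGroup V] [InnerProductSpace ℝ V] [CompleteSpace V]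
  {ρ : K →* SO V}

theorem IsSmoothRep.contMDiff_toEndHom (hρ : IsSmoothRep k ρ) :
    ContMDiff (𝓡 k) 𝓘(ℝ, V →L[ℝ] V) ∞ (SO.toEndHom.comp ρ) := hρ

variable [LieGroup (𝓡 k) ∞ K]

/-- A faithful smooth representation with closed image is a topological embedding: by the open
mapping theorem for `σ`-compact groups it is open onto its image. -/
theorem IsSmoothRep.isInducing [FiniteDimensional ℝ V] [SecondCountableTopology K]
    (hρ : IsSmoothRep k ρ) (hinj : Function.Injective ρ)
    (hclosed : IsClosed (ρ.range : Set (SO V))) : IsInducing ρ := by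
  have : IsTopologicalGroup K := topologicalGroup_of_lieGroup (𝓡 k) ∞
  have : LocallyCompactSpace K := ChartedSpace.locallyCompactSpace (EuclideanSpace ℝ (Fin k)) K
  have hcont : Continuous ρ := SO.isInducing_toEnd.continuous_iff.2 hρ.continuous
  have hemb : IsClosedEmbedding fun g : ρ.range => SO.toEnd (g : SO V) :=
    SO.isClosedEmbedding_toEnd.comp hclosed.isClosedEmbedding_subtypeVal
  have : LocallyCompactSpace ρ.range := hemb.locallyCompactSpace
  have hcont' : Continuous ρ.rangeRestrict := hcont.subtype_mk _
  have hopen := ρ.rangeRestrict.isOpenMap_of_sigmaCompact ρ.rangeRestrict_surjective hcont'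
  have hinj' : Function.Injective ρ.rangeRestrict := fun a b hab =>
    hinj (congrArg Subtype.val hab)
  exact IsInducing.subtypeVal.comp
    (IsOpenEmbedding.of_continuous_injective_isOpenMap hcont' hinj' hopen).isInducing

theorem repDeriv_lie (hρ : IsSmoothRep k ρ) (v w : GroupLieAlgebra (𝓡 k) K) :
    repDeriv k ρ ⁅v, w⁆ = ⁅repDeriv k ρ v, repDeriv k ρ w⁆ :=
  homDeriv_bracket hρ.contMDiff_toEndHom v w

theorem repDeriv_injective (hρ : IsSmoothRep k ρ) (hinj : Function.Injective ρ) :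
    Function.Injective (repDeriv k ρ) :=
  homDeriv_injective hρ.contMDiff_toEndHom (SO.toEnd_injective.comp hinj)

/-- A connected group whose Lie algebra lies in the image of `ρ_*` lies in the image of `ρ`. -/
theorem connectedSubgroup_le_range (hρ : IsSmoothRep k ρ) {q : Submodule ℝ (V →L[ℝ] V)}
    (hq : q ≤ LinearMap.range (repDeriv k ρ)) : connectedSubgroup q ≤ ρ.range := by
  refine (Subgroup.closure_le _).2 ?_
  rintro g ⟨X, hX, hg⟩
  obtain ⟨v, rfl⟩ := hq hX
  obtain ⟨a, ha⟩ := exp_homDeriv_mem_range hρ.contMDiff_toEndHom v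
  exact ⟨a, SO.toEnd_injective (ha.trans hg.symm)⟩

/-- If the image of an embedding `ρ` contains the connected group with Lie algebra `q`, then the
image of `ρ_*` contains `q`: the one-parameter groups of `q` lift to continuous curves. -/
theorem le_range_repDeriv [FiniteDimensional ℝ V] (hρ : IsSmoothRep k ρ)
    (hinj : Function.Injective ρ) (hind : IsInducing ρ) {q : Submodule ℝ (V →L[ℝ] V)}
    (hq : q ≤ skewAdjoint.submodule ℝ (V →L[ℝ] V)) (hqρ : connectedSubgroup q ≤ ρ.range) :
    q ≤ LinearMap.range (repDeriv k ρ) := by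
  intro X hX
  have hex : ∀ t : ℝ, ∃ a : K, SO.toEnd (ρ a) = NormedSpace.exp (t • X) := by
    intro t
    have htX : t • X ∈ q := q.smul_mem t hX
    obtain ⟨g, hg⟩ := exists_toEnd_eq_exp (hq htX)
    obtain ⟨a, rfl⟩ := hqρ (Subgroup.subset_closure ⟨_, htX, hg⟩)
    exact ⟨a, hg⟩
  choose c hc using hex
  have hcont : Continuous c := by
    rw [hind.continuous_iff, SO.isInducing_toEnd.continuous_iff]
    have h : SO.toEnd ∘ ρ ∘ c = fun t : ℝ => NormedSpace.exp (t • X) := funext hc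
    rw [h]
    let _ : NormedAlgebra ℚ (V →L[ℝ] V) := NormedAlgebra.restrictScalars ℚ ℝ (V →L[ℝ] V)
    exact NormedSpace.exp_continuous.comp (continuous_id.smul continuous_const)
  have h0 : c 0 = 1 := hinj (SO.toEnd_injective (by
    rw [hc, zero_smul, NormedSpace.exp_zero, map_one]; rfl))
  obtain ⟨v, hv⟩ := mem_range_homDeriv hρ.contMDiff_toEndHom
    (homDeriv_injective hρ.contMDiff_toEndHom (SO.toEnd_injective.comp hinj))
    hcont.continuousAt h0 hc
  exact ⟨v, hv⟩

end Representation

/-! ### Identification with `SU(2)` and `𝔰𝔲(2)` -/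

/-- Two Lie algebras which embed with the same image are isomorphic. -/
theorem LieEquiv.nonempty_of_range_eq {R L₁ L₂ L : Type*} [CommRing R] [LieRing L₁]
    [LieAlgebra R L₁] [LieRing L₂] [LieAlgebra R L₂] [LieRing L] [LieAlgebra R L]
    {f : L₁ →ₗ⁅R⁆ L} {g : L₂ →ₗ⁅R⁆ L} (hf : Function.Injective f) (hg : Function.Injective g)
    (h : Set.range f = Set.range g) : Nonempty (L₁ ≃ₗ⁅R⁆ L₂) :=
  ⟨(LieEquiv.ofInjective f hf).trans
    ((LieEquiv.ofEq _ _ (by rw [LieHom.coe_range, LieHom.coe_range, h])).trans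
      (LieEquiv.ofInjective g hg).symm)⟩

theorem nonempty_imQuaternion_equiv_su2 : Nonempty (imQuaternion ≃ₗ⁅ℝ⁆ su2) := by
  refine LieEquiv.nonempty_of_range_eq
    (f := (quaternionToMatrix : ℍ[ℝ] →ₗ⁅ℝ⁆ Matrix (Fin 2) (Fin 2) ℂ).comp imQuaternion.incl)
    (g := su2.incl) ?_ Subtype.val_injective ?_
  · exact (quaternionToMatrix : ℍ[ℝ] →+* Matrix (Fin 2) (Fin 2) ℂ).injective.comp
      Subtype.val_injective
  · rw [← map_imQuaternion_toMatrix]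
    ext A
    simp [LieSubalgebra.mem_map]

section Representation

variable {k : ℕ} {K : Type*} [TopologicalSpace K] [ChartedSpace (EuclideanSpace ℝ (Fin k)) K]
  [Group K] [LieGroup (𝓡 k) ∞ K]
  {V : Type*} [NormedAddCommGroup V] [InnerProductSpace ℝ V] [CompleteSpace V]
  [Nontrivial V]
  {ρ : K →* SO V} {q : Submodule ℝ (V →L[ℝ] V)} {Φ : ℍ[ℝ] →ₐ[ℝ] (V →L[ℝ] V)}

theorem nonempty_lieEquiv_su2 (hρ : IsSmoothRep k ρ) (hinj : Function.Injective ρ)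
    (hΦ : imQuaternion.toSubmodule.map Φ.toLinearMap = q)
    (s : LieSubalgebra ℝ (GroupLieAlgebra (𝓡 k) K))
    (hs : s.toSubmodule.map (repDeriv k ρ) = q) : Nonempty (s ≃ₗ⁅ℝ⁆ su2) := by
  let δ : GroupLieAlgebra (𝓡 k) K →ₗ⁅ℝ⁆ (V →L[ℝ] V) :=
    { repDeriv k ρ with map_lie' := fun {v w} => repDeriv_lie hρ v w }
  obtain ⟨e⟩ := nonempty_imQuaternion_equiv_su2
  obtain ⟨e'⟩ : Nonempty (s ≃ₗ⁅ℝ⁆ imQuaternion) := by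
    refine LieEquiv.nonempty_of_range_eq (f := δ.comp s.incl)
      (g := (Φ : ℍ[ℝ] →ₗ⁅ℝ⁆ (V →L[ℝ] V)).comp imQuaternion.incl)
      ((repDeriv_injective hρ hinj).comp Subtype.val_injective)
      ((Quaternion.algHom_injective Φ).comp Subtype.val_injective) ?_
    have h := congrArg (fun p : Submodule ℝ (V →L[ℝ] V) => (p : Set (V →L[ℝ] V))) (hs.trans hΦ.symm)
    ext X
    constructor
    · rintro ⟨v, rfl⟩
      obtain ⟨x, hx, hxv⟩ := h.subset ⟨v, v.2, rfl⟩
      exact ⟨⟨x, hx⟩, hxv⟩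
    · rintro ⟨x, rfl⟩
      obtain ⟨v, hv, hxv⟩ := h.superset ⟨x, x.2, rfl⟩
      exact ⟨⟨v, hv⟩, hxv⟩
  exact ⟨e'.trans e⟩

theorem nonempty_continuousMulEquiv_specialUnitaryGroup [FiniteDimensional ℝ V]
    {K : Type*} [TopologicalSpace K] [T2Space K] [Group K] {ρ : K →* SO V}
    (hinj : Function.Injective ρ) (hind : IsInducing ρ)
    (hq : q ≤ skewAdjoint.submodule ℝ (V →L[ℝ] V))
    (hΦ : imQuaternion.toSubmodule.map Φ.toLinearMap = q) (S : Subgroup K)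
    (hS : S.map ρ = connectedSubgroup q) :
    Nonempty (S ≃ₜ* Matrix.specialUnitaryGroup (Fin 2) ℂ) := by
  obtain ⟨e, he⟩ := exists_unitQuaternion_equiv hq hΦ
  let e' : S ≃* connectedSubgroup q :=
    (S.equivMapOfInjective ρ hinj).trans (MulEquiv.subgroupCongr hS)
  have hρe : ∀ u : Metric.sphere (0 : ℍ[ℝ]) 1, SO.toEnd (ρ ((e.trans e'.symm) u : K)) = Φ u :=
    fun u => by
      rw [← he u]
      exact congrArg (fun g : connectedSubgroup q => SO.toEnd (g : SO V))
        (e'.apply_symm_apply (e u))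
  have hcont : Continuous (e.trans e'.symm) := by
    rw [IsInducing.subtypeVal.continuous_iff, hind.continuous_iff,
      SO.isInducing_toEnd.continuous_iff]
    exact ((Quaternion.algHom_continuous Φ).comp continuous_subtype_val).congr
      fun u => (hρe u).symm
  obtain ⟨e''⟩ := nonempty_unitQuaternion_equiv_specialUnitaryGroup
  have : CompactSpace (Metric.sphere (0 : ℍ[ℝ]) 1) :=
    isCompact_iff_compactSpace.1 (isCompact_sphere 0 1)
  exact ⟨(ContinuousMulEquiv.ofContinuousBijective (e.trans e'.symm).toMonoidHom hcont
    (e.trans e'.symm).bijective).symm.trans e''⟩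

end Representation

theorem proposition3p1 (n : ℕ)
    {V : Type*} [NormedAddCommGroup V] [InnerProductSpace ℝ V] [CompleteSpace V]
    (hV : Module.finrank ℝ V = 4 * n + 4) (F : SphereFoliation V) (hF : F.IsClosedFoliation)
    {k : ℕ} {K : Type*} [TopologicalSpace K] [ChartedSpace (EuclideanSpace ℝ (Fin k)) K] [Group K]
    [LieGroup (𝓡 k) ∞ K] [T2Space K] [SecondCountableTopology K]
    (ρ : K →* SO V)
    (hρ_smooth : IsSmoothRep k ρ) (hρ_effective : Function.Injective ρ)
    (hρ_max : IsMaximalConnectedInvariant F ρ.range)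
    (q : Submodule ℝ (V →L[ℝ] V))
    (hq : IsQuaternionicStructure q) :
    [PreservesFoliation F q,
      (∃ S : Subgroup K, S.map ρ = connectedSubgroup q),
      (∃ s : LieSubalgebra ℝ (GroupLieAlgebra (𝓡 k) K),
        s.toSubmodule.map (repDeriv k ρ) = q)].TFAE ∧
    (∀ S : Subgroup K, S.map ρ = connectedSubgroup q →
      Nonempty (S ≃ₜ* Matrix.specialUnitaryGroup (Fin 2) ℂ)) ∧
    (∀ s : LieSubalgebra ℝ (GroupLieAlgebra (𝓡 k) K),
      s.toSubmodule.map (repDeriv k ρ) = q → Nonempty (s ≃ₗ⁅ℝ⁆ su2)) := by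
  have : FiniteDimensional ℝ V := FiniteDimensional.of_finrank_pos (by lia)
  have : Nontrivial V := Module.nontrivial_of_finrank_pos (R := ℝ) (by lia)
  obtain ⟨Φ, hΦ⟩ := hq.exists_algHom
  have hind : IsInducing ρ :=
    hρ_smooth.isInducing hρ_effective (hρ_max.isClosed hF)
  refine ⟨?_, fun S hS => ?_, fun s hs => ?_⟩
  · tfae_have 1 → 2 := fun h => by
      have hle : connectedSubgroup q ≤ ρ.range :=
        hρ_max.2 ⟨isConnected_connectedSubgroup hq.1 hΦ, h.leavesInvariant⟩
      exact ⟨(connectedSubgroup q).comap ρ, Subgroup.map_comap_eq_self hle⟩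
    tfae_have 2 → 3 := fun ⟨S, hS⟩ => by
      have hle : q ≤ LinearMap.range (repDeriv k ρ) :=
        le_range_repDeriv hρ_smooth hρ_effective hind hq.1
          (hS ▸ Subgroup.map_le_range ρ S)
      -- `q` is closed under brackets, being the image of the imaginary quaternions
      refine ⟨{ q.comap (repDeriv k ρ) with lie_mem' := fun {v w} hv hw => ?_ },
        Submodule.map_comap_eq_of_le hle⟩
      have hv' : repDeriv k ρ v ∈ q := hv
      have hw' : repDeriv k ρ w ∈ q := hw
      change repDeriv k ρ ⁅v, w⁆ ∈ q
      rw [repDeriv_lie hρ_smooth]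
      rw [← hΦ] at hv' hw' ⊢
      obtain ⟨x, hx, hxv⟩ := hv'
      obtain ⟨y, hy, hyw⟩ := hw'
      refine ⟨⁅x, y⁆, imQuaternion.lie_mem hx hy, ?_⟩
      rw [← hxv, ← hyw]
      exact LieHom.map_lie (Φ : ℍ[ℝ] →ₗ⁅ℝ⁆ (V →L[ℝ] V)) x y
    tfae_have 3 → 1 := fun ⟨s, hs⟩ =>
      hρ_max.1.2.preservesFoliation
        (connectedSubgroup_le_range hρ_smooth (hs ▸ LinearMap.map_le_range))
    tfae_finish
  · exact nonempty_continuousMulEquiv_specialUnitaryGroup hρ_effective hind hq.1 hΦ S hS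
  · exact nonempty_lieEquiv_su2 hρ_smooth hρ_effective hΦ s hs
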